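/- Let $k$ be an algebraically closed field and $N \ge 1$. For a sequence of integers $\overline{n}=(n_1,\dots,n_r)$ let $z_{ij}$ ($1\le i\le r$, $0\le j\le N$) be independent indeterminates over $k$, let $k(\mathbf z)$ be their field of rational functions, let $P_i=[z_{i0}:\dots:z_{iN}]\in\mathbb P^N_{k(\mathbf z)}$ be the corresponding $r$ generic points, let $\mathfrak p_i\subset k(\mathbf z)[x_0,\dots,x_N]$ be the homogeneous ideal of $P_i$, and put $$I(\overline n)=\mathfrak p_1^{n_1}\cap\dots\cap\mathfrak p_r^{n_r},$$ the ideal of $r$ generic points with multiplicities $n_1,\dots,n_r$, where $\mathfrak p_i^{n_i}$ is the whole ring if $n_i\le 0$. For a nonzero homogeneous ideal $I$ of a polynomial ring $R$ over a field, let $\alpha(I)$ be the least degree of a nonzero homogeneous element of $I$, let $I^{(m)}=\bigcap_{\mathfrak p\in\operatorname{Ass}(R/I)}(I^mR_{\mathfrak p}\cap R)$ be its $m$-th symbolic power, and let $$\widehat\alpha(I)=\lim_{m\to\infty}\frac{\alpha(I^{(m)})}{m}=\inf_{m\ge1}\frac{\alpha(I^{(m)})}{m}$$ be its Waldschmidt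 constant. Write $a^{\times t}$ for the sequence $a,\dots,a$ ($t$ times). Then for every finite sequence of multiplicities $\overline m=(m_1,\dots,m_s)$, $$\widehat\alpha\big(I(1^{\times 2^N},\overline m)\big)\ \ge\ \widehat\alpha\big(I(2,\overline m)\big),$$ and, for every integer $b\ge0$, $$\widehat\alpha\big(I(1^{\times b\cdot 2^N},\overline m)\big)\ \ge\ \widehat\alpha\big(I(2^{\times b},\overline m)\big).$$ -/

import Mathlib

open Filter Topology

noncomputable section

namespace FatPoints

/-- The `m`-th symbolic power `I⁽ᵐ⁾ = ⋂_{𝔭 ∈ Ass(R/I)} (I^m R_𝔭 ∩ R)` of an ideal. -/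
def symbolicPower {R : Type*} [CommRing R] (I : Ideal R) (m : ℕ) : Ideal R :=
  ⨅ p : PrimeSpectrum R, ⨅ _ : p.asIdeal ∈ associatedPrimes R (R ⧸ I),
    ((I ^ m).map (algebraMap R (Localization.AtPrime p.asIdeal))).comap
      (algebraMap R (Localization.AtPrime p.asIdeal))

/-- `α(I)`: the least degree of a nonzero homogeneous element of `I`, which for a nonzero
homogeneous ideal is its least generating degree. -/
def initialDegree {σ K : Type*} [Field K] (I : Ideal (MvPolynomial σ K)) : ℕ :=
  sInf {d : ℕ | ∃ f ∈ I, f ≠ 0 ∧ f.IsHomogeneous d}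

/-- The Waldschmidt constant `inf_{m ≥ 1} α(I⁽ᵐ⁾) / m`; it is also the limit of this sequence, see
`tendsto_waldschmidtConstant`. -/
def waldschmidtConstant {σ K : Type*} [Field K] (I : Ideal (MvPolynomial σ K)) : ℝ :=
  ⨅ m : ℕ+, (initialDegree (symbolicPower I m) : ℝ) / (m : ℕ)

/-- The homogeneous defining ideal of the point of projective space with homogeneous coordinates
`P` (not all zero): the ideal generated by the homogeneous polynomials vanishing at `P`. -/
def pointIdeal {σ K : Type*} [Field K] (P : σ → K) : Ideal (MvPolynomial σ K) :=
  Ideal.span {f | (∃ d : ℕ, f.IsHomogeneous d) ∧ MvPolynomial.eval P f = 0}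

/-- The ideal `⋂ᵢ 𝔭ᵢ ^ mᵢ` of the points `P i` with multiplicities `m i`. A multiplicity `m i ≤ 0`
imposes no condition, `𝔭ᵢ ^ mᵢ` being then the whole ring. -/
def fatPointIdeal {σ K ι : Type*} [Field K] (P : ι → σ → K) (m : ι → ℤ) :
    Ideal (MvPolynomial σ K) :=
  ⨅ i, pointIdeal (P i) ^ (m i).toNat

/-- The field `k(𝐳)` of rational functions in indeterminates `z i j`, for `i : ι` and
`0 ≤ j ≤ N`. -/
abbrev GenericField (k : Type*) [Field k] (N : ℕ) (ι : Type*) : Type _ :=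
  FractionRing (MvPolynomial (ι × Fin (N + 1)) k)

/-- Homogeneous coordinates `[z i 0 : … : z i N]` of the generic points of `ℙ^N` over `k(𝐳)`. -/
def genericPointCoords (k : Type*) [Field k] (N : ℕ) {ι : Type*} (i : ι) (j : Fin (N + 1)) :
    GenericField k N ι :=
  algebraMap (MvPolynomial (ι × Fin (N + 1)) k) (GenericField k N ι) (MvPolynomial.X (i, j))

/-- The ideal `I(m)` in `k(𝐳)[x₀, …, x_N]` of generic points of `ℙ^N`, indexed by `ι`, with
multiplicities `m i`. -/
def genericFatPointIdeal (k : Type*) [Field k] (N : ℕ) {ι : Type*} (m : ι → ℤ) :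
    Ideal (MvPolynomial (Fin (N + 1)) (GenericField k N ι)) :=
  fatPointIdeal (genericPointCoords k N) m

theorem mem_symbolicPower_mul {R : Type*} [CommRing R] {I : Ideal R} {m n : ℕ} {f g : R}
    (hf : f ∈ symbolicPower I m) (hg : g ∈ symbolicPower I n) :
    f * g ∈ symbolicPower I (m + n) := by
  simp only [symbolicPower, Ideal.mem_iInf, Ideal.mem_comap] at *
  intro p hp
  rw [map_mul, pow_add, Ideal.map_mul]
  exact Ideal.mul_mem_mul (hf p hp) (hg p hp)

theorem pow_mem_symbolicPower {R : Type*} [CommRing R] {I : Ideal R} {f : R} (hf : f ∈ I)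
    (m : ℕ) : f ^ m ∈ symbolicPower I m := by
  simp only [symbolicPower, Ideal.mem_iInf, Ideal.mem_comap]
  intro p _
  exact Ideal.mem_map_of_mem _ (Ideal.pow_mem_pow hf m)

/-- For an ideal containing a nonzero homogeneous element, the Waldschmidt constant is the limit
of `α(I⁽ᵐ⁾) / m`. -/
theorem tendsto_waldschmidtConstant {σ K : Type*} [Field K] (I : Ideal (MvPolynomial σ K))
    (hI : ∃ f ∈ I, f ≠ 0 ∧ ∃ d : ℕ, f.IsHomogeneous d) :
    Tendsto (fun m : ℕ => (initialDegree (symbolicPower I m) : ℝ) / m) atTop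
      (𝓝 (waldschmidtConstant I)) := by
  obtain ⟨f, hf, hf0, d, hd⟩ := hI
  have hne : ∀ m, {d : ℕ | ∃ f ∈ symbolicPower I m, f ≠ 0 ∧ f.IsHomogeneous d}.Nonempty :=
    fun m => ⟨d * m, f ^ m, pow_mem_symbolicPower hf m, pow_ne_zero m hf0, hd.pow m⟩
  have hsub : Subadditive fun m : ℕ => (initialDegree (symbolicPower I m) : ℝ) := by
    intro m n
    obtain ⟨g, hg, hg0, hgd⟩ := Nat.sInf_mem (hne m)
    obtain ⟨h, hh, hh0, hhd⟩ := Nat.sInf_mem (hne n)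
    have key : initialDegree (symbolicPower I (m + n)) ≤
        initialDegree (symbolicPower I m) + initialDegree (symbolicPower I n) :=
      Nat.sInf_le ⟨g * h, mem_symbolicPower_mul hg hh, mul_ne_zero hg0 hh0, hgd.mul hhd⟩
    simpa only [Nat.cast_add] using (Nat.cast_le (α := ℝ)).2 key
  have hbdd : BddBelow (Set.range fun n : ℕ =>
      (initialDegree (symbolicPower I n) : ℝ) / n) :=
    ⟨0, by rintro _ ⟨n, rfl⟩; positivity⟩
  have hlim : hsub.lim = waldschmidtConstant I := by
    unfold Subadditive.lim waldschmidtConstant iInf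
    congr 1
    ext x
    constructor
    · rintro ⟨n, hn, rfl⟩
      exact ⟨⟨n, hn⟩, rfl⟩
    · rintro ⟨n, rfl⟩
      exact ⟨n, n.pos, rfl⟩
  exact hlim ▸ hsub.tendsto_lim hbdd

end FatPoints

end

/-! Degenerate the simple points to cubes. Let a form of degree `d` vanish to order `M` at the
simple points and suitably at the others. This is a homogeneous linear system in its coefficients,
so solvability survives specialization (`exists_isHomogeneous_of_specialization`). Over `K[t]`, with
`K` the field of the target generic points, send each batch of `2 ^ N` points to the vertices `Q + t
ε`, `ε ∈ {0,1}^N`, of a small cube around a generic point `Q`. Divide the resulting form by its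
power of `t` and set `t = 0`: the limit should vanish to order `2 M` at `Q`.

To see this, substitute `y ↦ t y` in local coordinates at `Q`, so that the cube gets fixed size, and
let `t ^ e` be the exact power of `t` dividing the result. The quotient modulo `t` is nonzero, has
degree at most `e`, and vanishes to order `M` on a fixed grid `{0,c}^N`. Such a polynomial has
degree at least `2 M` (`two_mul_le_totalDegree`), so `2 M ≤ e`. Every term of degree `a` surviving
at `t = 0` forces `e ≤ a`, hence `2 M ≤ a` (`map_mem_pow_two_mul_of_collision`).

Symbolic powers of fat point ideals just multiply the multiplicities
(`mem_symbolicPower_fatPointIdeal_iff`), so initial degrees compare for every `M`, and so do the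
infima. -/

open Filter Topology

noncomputable section

namespace FatPoints

open MvPolynomial

/-! ### Order of vanishing at the origin. -/

section IdealOfVars

variable {σ A : Type*} [CommRing A]

theorem mem_pow_idealOfVars_iff_le_order (n : ℕ) (f : MvPolynomial σ A) :
    f ∈ idealOfVars σ A ^ n ↔ (n : ℕ∞) ≤ (f : MvPowerSeries σ A).order := by
  rw [mem_pow_idealOfVars_iff']
  refine ⟨fun h => MvPowerSeries.nat_le_order fun d hd => ?_, fun h x hx => ?_⟩
  · rw [coeff_coe]
    exact h d hd
  · rw [← coeff_coe]
    exact MvPowerSeries.coeff_of_lt_order (lt_of_lt_of_le (by exact_mod_cast hx) h)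

/-- Over a domain the order of a power series is additive on products, so a factor of order at most
`a` absorbs at most `a` of the vanishing. -/
theorem mem_pow_add_idealOfVars_of_mul [IsDomain A] {s f : MvPolynomial σ A} {a n : ℕ}
    (hs : s ∉ idealOfVars σ A ^ (a + 1)) (h : s * f ∈ idealOfVars σ A ^ (a + n)) :
    f ∈ idealOfVars σ A ^ n := by
  rw [mem_pow_idealOfVars_iff_le_order] at *
  rw [coe_mul, MvPowerSeries.order_mul] at h
  push Not at hs
  have hs' : (s : MvPowerSeries σ A).order ≤ a := by
    exact Order.le_of_lt_add_one (by exact_mod_cast hs)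
  have := h.trans (add_le_add_left hs' _)
  push_cast at this
  exact (ENat.add_le_add_iff_left (ENat.natCast_ne_top a)).1 this

theorem mem_pow_idealOfVars_of_mul [IsDomain A] {s f : MvPolynomial σ A} {n : ℕ}
    (hs : s ∉ idealOfVars σ A) (h : s * f ∈ idealOfVars σ A ^ n) :
    f ∈ idealOfVars σ A ^ n :=
  mem_pow_add_idealOfVars_of_mul (a := 0) (by simpa using hs) (by simpa using h)

theorem mem_idealOfVars_iff (f : MvPolynomial σ A) :
    f ∈ idealOfVars σ A ↔ constantCoeff f = 0 := by
  rw [← pow_one (idealOfVars σ A), mem_pow_idealOfVars_iff']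
  simp only [Nat.lt_one_iff, Finsupp.degree_eq_zero_iff, forall_eq, constantCoeff_eq]

end IdealOfVars

/-! ### Local coordinates along the line over a point. -/

/-- The expansion of a form along the line `{L • P}`: the substitution `x₀ ↦ L P₀`,
`xⱼ₊₁ ↦ L Pⱼ₊₁ + yⱼ`. -/
def localExpansion {R : Type*} [CommRing R] {n : ℕ} (P : Fin (n + 1) → R) :
    MvPolynomial (Fin (n + 1)) R →ₐ[R] MvPolynomial (Fin n) (Polynomial R) :=
  aeval fun i => C (Polynomial.X * Polynomial.C (P i)) + Fin.cases 0 X i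

theorem localExpansion_X {R : Type*} [CommRing R] {n : ℕ} (P : Fin (n + 1) → R)
    (i : Fin (n + 1)) : localExpansion P (X i) =
      C (Polynomial.X * Polynomial.C (P i)) + Fin.cases 0 X i := by
  simp [localExpansion]

theorem localExpansion_C {R : Type*} [CommRing R] {n : ℕ} (P : Fin (n + 1) → R)
    (r : R) : localExpansion P (C r) = C (Polynomial.C r) := by
  simp [localExpansion, MvPolynomial.algebraMap_apply]

theorem map_localExpansion {R S : Type*} [CommRing R] [CommRing S] (φ : R →+* S) {n : ℕ}
    (P : Fin (n + 1) → R) (F : MvPolynomial (Fin (n + 1)) R) :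
    MvPolynomial.map (Polynomial.mapRingHom φ) (localExpansion P F) =
      localExpansion (φ ∘ P) (MvPolynomial.map φ F) := by
  induction F using MvPolynomial.induction_on with
  | C r => simp
  | add f g hf hg => simp [hf, hg]
  | mul_X f i hf =>
    simp only [map_mul, hf, localExpansion_X, map_X, map_add, map_C, Function.comp]
    congr 2
    · simp
    · refine Fin.cases ?_ (fun j => ?_) i <;> simp

theorem coe_eval_constantCoeff_localExpansion {R : Type*} [CommRing R] {n : ℕ}
    (P : Fin (n + 1) → R) (F : MvPolynomial (Fin (n + 1)) R) (c : R) :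
    (constantCoeff (localExpansion P F)).eval c = eval (c • P) F := by
  induction F using MvPolynomial.induction_on with
  | C r => simp
  | add f g hf hg => simp [hf, hg]
  | mul_X f i hf =>
    simp only [map_mul, Polynomial.eval_mul, hf, localExpansion_X, map_add, constantCoeff_C,
      eval_X, Pi.smul_apply, smul_eq_mul]
    congr 1
    refine Fin.cases ?_ (fun j => ?_) i <;> simpa using mul_comm _ _

/-! ### Powers of the ideal of a point as order conditions. -/

section PointIdeal

variable {K : Type*} [Field K] {n : ℕ}

theorem eval_smul_of_isHomogeneous {σ : Type*} {F : MvPolynomial σ K} {d : ℕ}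
    (hF : F.IsHomogeneous d) (c : K) (P : σ → K) : eval (c • P) F = c ^ d * eval P F := by
  rw [eval_eq, eval_eq, Finset.mul_sum]
  refine Finset.sum_congr rfl fun a ha => ?_
  have hd : ∑ i ∈ a.support, a i = d := by
    have := hF (mem_support_iff.1 ha)
    rwa [Pi.one_def, ← Finsupp.degree_eq_weight_one] at this
  simp only [Pi.smul_apply, smul_eq_mul, mul_pow, Finset.prod_mul_distrib,
    Finset.prod_pow_eq_pow_sum, hd]
  ring

theorem eval_eq_zero_of_mem_pointIdeal {σ : Type*} {P : σ → K} {F : MvPolynomial σ K}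
    (hF : F ∈ pointIdeal P) : eval P F = 0 := by
  have : pointIdeal P ≤ RingHom.ker (eval P) :=
    Ideal.span_le.2 fun f hf => hf.2
  exact this hF

theorem C_mul_X_sub_mem_pointIdeal {σ : Type*} (P : σ → K) (i j : σ) :
    C (P i) * X j - C (P j) * X i ∈ pointIdeal P :=
  Ideal.subset_span ⟨⟨1, ((isHomogeneous_X K j).C_mul _).sub ((isHomogeneous_X K i).C_mul _)⟩,
    by simp [mul_comm]⟩

theorem pointIdeal_le_comap [Infinite K] (P : Fin (n + 1) → K) :
    pointIdeal P ≤ (idealOfVars (Fin n) (Polynomial K)).comap (localExpansion P) := by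
  refine Ideal.span_le.2 ?_
  rintro f ⟨⟨d, hd⟩, h0⟩
  rw [SetLike.mem_coe, Ideal.mem_comap, mem_idealOfVars_iff]
  -- The part constant in `y` is `F(L P) = L ^ d F(P)`; over an infinite field it suffices to check
  -- its values.
  refine Polynomial.funext fun c => ?_
  rw [coe_eval_constantCoeff_localExpansion, eval_smul_of_isHomogeneous hd, h0]
  simp

/-- The inverse of `localExpansion`. -/
def localContraction (P : Fin (n + 1) → K) :
    MvPolynomial (Fin n) (Polynomial K) →+* MvPolynomial (Fin (n + 1)) K :=
  eval₂Hom (Polynomial.aeval (C (P 0)⁻¹ * X 0)).toRingHom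
    fun j => X j.succ - C ((P 0)⁻¹ * P j.succ) * X 0

theorem localContraction_localExpansion {P : Fin (n + 1) → K} (h : P 0 ≠ 0)
    (F : MvPolynomial (Fin (n + 1)) K) : localContraction P (localExpansion P F) = F := by
  induction F using MvPolynomial.induction_on with
  | C r => simp [localContraction, MvPolynomial.algebraMap_eq]
  | add f g hf hg => simp [hf, hg]
  | mul_X f i hf =>
    rw [map_mul, map_mul, hf, localExpansion_X]
    congr 1
    refine Fin.cases ?_ (fun j => ?_) i
    · simp only [localContraction, map_mul, coe_eval₂Hom, eval₂_C, Fin.cases_zero, add_zero]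
      simp only [AlgHom.toRingHom_eq_coe, RingHom.coe_coe, Polynomial.aeval_X, Polynomial.aeval_C,
        MvPolynomial.algebraMap_eq]
      rw [mul_right_comm, ← C_mul, inv_mul_cancel₀ h, C_1, one_mul]
    · simp only [localContraction, map_add, map_mul, coe_eval₂Hom, eval₂_C, Fin.cases_succ,
        eval₂_X]
      simp only [AlgHom.toRingHom_eq_coe, RingHom.coe_coe, Polynomial.aeval_X, Polynomial.aeval_C,
        MvPolynomial.algebraMap_eq]
      ring

theorem map_localContraction_le {P : Fin (n + 1) → K} (h : P 0 ≠ 0) :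
    (idealOfVars (Fin n) (Polynomial K)).map (localContraction P) ≤ pointIdeal P := by
  rw [idealOfVars, Ideal.map_span, Ideal.span_le]
  rintro _ ⟨_, ⟨j, rfl⟩, rfl⟩
  have := Ideal.mul_mem_left _ (C (P 0)⁻¹) (C_mul_X_sub_mem_pointIdeal P 0 j.succ)
  have e : C (P 0)⁻¹ * (C (P 0) * X j.succ - C (P j.succ) * X 0) =
      localContraction P (X j) := by
    rw [mul_sub, ← mul_assoc, ← mul_assoc, ← C_mul, ← C_mul, inv_mul_cancel₀ h]
    simp [localContraction]
  rw [SetLike.mem_coe, ← e]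
  exact this

/-- When `P 0 ≠ 0` the expansion is an invertible linear change of variables carrying the ideal of
the point to the ideal of the `y`'s, so no dehomogenization is needed. -/
theorem mem_pointIdeal_pow_iff [Infinite K] {P : Fin (n + 1) → K} (h : P 0 ≠ 0) (m : ℕ)
    (F : MvPolynomial (Fin (n + 1)) K) :
    F ∈ pointIdeal P ^ m ↔ localExpansion P F ∈ idealOfVars (Fin n) (Polynomial K) ^ m := by
  constructor
  · intro hF
    have := Ideal.pow_right_mono (pointIdeal_le_comap P) m hF
    exact Ideal.le_comap_pow _ m this
  · intro hF
    rw [← localContraction_localExpansion h F]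
    have := Ideal.mem_map_of_mem (localContraction P) hF
    rw [Ideal.map_pow] at this
    exact Ideal.pow_right_mono (map_localContraction_le h) m this

theorem mem_pointIdeal_iff [Infinite K] {P : Fin (n + 1) → K} (h : P 0 ≠ 0)
    (F : MvPolynomial (Fin (n + 1)) K) :
    F ∈ pointIdeal P ↔ localExpansion P F ∈ idealOfVars (Fin n) (Polynomial K) := by
  simpa using mem_pointIdeal_pow_iff h 1 F

theorem pointIdeal_isPrime [Infinite K] {P : Fin (n + 1) → K} (h : P 0 ≠ 0) :
    (pointIdeal P).IsPrime := by
  refine ⟨fun ht => ?_, fun {x y} hxy => ?_⟩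
  · have h1 : (1 : MvPolynomial (Fin (n + 1)) K) ∈ pointIdeal P := ht ▸ Submodule.mem_top
    simpa using eval_eq_zero_of_mem_pointIdeal h1
  · simp only [mem_pointIdeal_iff h, mem_idealOfVars_iff] at *
    simpa using hxy

/-- Powers of the ideal of a point are primary: a multiplier outside it has order zero in `y`. -/
theorem mem_pointIdeal_pow_of_mul [Infinite K] {P : Fin (n + 1) → K} (h : P 0 ≠ 0) {m : ℕ}
    {s F : MvPolynomial (Fin (n + 1)) K} (hs : s ∉ pointIdeal P)
    (hF : s * F ∈ pointIdeal P ^ m) : F ∈ pointIdeal P ^ m := by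
  rw [mem_pointIdeal_pow_iff h] at *
  rw [mem_pointIdeal_iff h] at hs
  exact mem_pow_idealOfVars_of_mul hs (by simpa using hF)

theorem not_pointIdeal_le {σ : Type*} {P Q : σ → K} {i j : σ} (h : P i * Q j ≠ P j * Q i) :
    ¬ pointIdeal P ≤ pointIdeal Q := by
  intro hle
  have := eval_eq_zero_of_mem_pointIdeal (hle (C_mul_X_sub_mem_pointIdeal P i j))
  simp only [map_sub, map_mul, eval_C, eval_X] at this
  exact h (sub_eq_zero.1 this)

end PointIdeal

/-! ### Symbolic powers of fat point ideals. -/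

section SymbolicPower

theorem mem_map_localization_iff {R : Type*} [CommRing R] (I p : Ideal R) [p.IsPrime] (x : R) :
    x ∈ (I.map (algebraMap R (Localization.AtPrime p))).comap
      (algebraMap R (Localization.AtPrime p)) ↔ ∃ s ∉ p, s * x ∈ I := by
  rw [Ideal.mem_comap, IsLocalization.algebraMap_mem_map_algebraMap_iff p.primeCompl]
  rfl

theorem fatPointIdeal_le {σ K ι : Type*} [Field K] (P : ι → σ → K) (m : ι → ℤ) (i : ι) :
    fatPointIdeal P m ≤ pointIdeal (P i) ^ (m i).toNat := iInf_le _ i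

/-- Needed because `sInf ∅ = 0`: it ensures that the initial degree is attained. The witness is a
product of powers of linear forms through the points. -/
theorem exists_isHomogeneous_mem_symbolicPower {K : Type*} [Field K] {n : ℕ} {ι : Type*}
    [Finite ι] {P : ι → Fin (n + 1) → K} (hP : ∀ i, ∃ a b, a ≠ b ∧ P i a ≠ 0) (m : ι → ℤ) (M : ℕ) :
    ∃ F ∈ symbolicPower (fatPointIdeal P m) M, F ≠ 0 ∧ ∃ d, F.IsHomogeneous d := by
  have := Fintype.ofFinite ι
  choose a b hab ha using hP
  let f : ι → MvPolynomial (Fin (n + 1)) K := fun i =>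
    C (P i (a i)) * X (b i) - C (P i (b i)) * X (a i)
  have hf0 : ∀ i, f i ≠ 0 := by
    intro i hi
    have := congrArg (eval (Pi.single (b i) 1)) hi
    simp [f, Pi.single_eq_of_ne (hab i), ha i] at this
  have hf1 : ∀ i, (f i).IsHomogeneous 1 := fun i =>
    ((isHomogeneous_X K _).C_mul _).sub ((isHomogeneous_X K _).C_mul _)
  refine ⟨(∏ i, f i ^ (m i).toNat) ^ M, pow_mem_symbolicPower (Ideal.mem_iInf.2 fun i => ?_) M,
    pow_ne_zero _ (Finset.prod_ne_zero_iff.2 fun i _ => pow_ne_zero _ (hf0 i)), _,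
    (IsHomogeneous.prod _ _ _ fun i _ => (hf1 i).pow (m i).toNat).pow M⟩
  exact Ideal.mem_of_dvd _ (Finset.dvd_prod_of_mem _ (Finset.mem_univ i))
    (Ideal.pow_mem_pow (C_mul_X_sub_mem_pointIdeal _ _ _) _)

variable {K : Type*} [Field K] [Infinite K] {n : ℕ} {ι : Type*} [Finite ι]
  {P : ι → Fin (n + 1) → K}

theorem exists_mem_forall_ne_pow_notMem (h0 : ∀ i, P i 0 ≠ 0)
    (hd : ∀ i j, i ≠ j → ¬ pointIdeal (P i) ≤ pointIdeal (P j)) (e : ι → ℕ) (i : ι) :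
    ∃ s ∉ pointIdeal (P i), ∀ j, j ≠ i → s ∈ pointIdeal (P j) ^ e j := by
  classical
  have := Fintype.ofFinite ι
  have hp := pointIdeal_isPrime (h0 i)
  choose f hf hf' using fun j : {j // j ≠ i} => Set.not_subset.1 (hd j i j.2)
  refine ⟨∏ j : {j // j ≠ i}, f j ^ e j, ?_, fun j hj => ?_⟩
  · rw [hp.prod_mem_iff]
    rintro ⟨j, -, hj⟩
    exact hf' j (hp.mem_of_pow_mem _ hj)
  · exact Ideal.mem_of_dvd _ (Finset.dvd_prod_of_mem _ (Finset.mem_univ ⟨j, hj⟩))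
      (Ideal.pow_mem_pow (hf ⟨j, hj⟩) _)

/-- Multiply a power of an element of `𝔭ᵢ` by some `s ∉ 𝔭ᵢ` lying deep in the other ideals: the
product is in `q`, but `s` is not. -/
theorem eq_pointIdeal_of_fatPointIdeal_le (h0 : ∀ i, P i 0 ≠ 0)
    (hd : ∀ i j, i ≠ j → ¬ pointIdeal (P i) ≤ pointIdeal (P j)) (m : ι → ℤ) (i : ι)
    {q : Ideal (MvPolynomial (Fin (n + 1)) K)} [hq : q.IsPrime] (hq' : fatPointIdeal P m ≤ q)
    (hqi : q ≤ pointIdeal (P i)) : q = pointIdeal (P i) := by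
  obtain ⟨s, hs, hs'⟩ := exists_mem_forall_ne_pow_notMem h0 hd (fun j => (m j).toNat) i
  refine le_antisymm hqi fun x hx => ?_
  have : s * x ^ (m i).toNat ∈ fatPointIdeal P m := by
    refine Ideal.mem_iInf.2 fun j => ?_
    by_cases hj : j = i
    · subst hj
      exact Ideal.mul_mem_left _ _ (Ideal.pow_mem_pow hx _)
    · exact Ideal.mul_mem_right _ _ (hs' j hj)
  rcases hq.mem_or_mem (hq' this) with h | h
  · exact absurd (hqi h) hs
  · exact hq.mem_of_pow_mem _ h

theorem pointIdeal_mem_associatedPrimes (h0 : ∀ i, P i 0 ≠ 0)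
    (hd : ∀ i j, i ≠ j → ¬ pointIdeal (P i) ≤ pointIdeal (P j)) (m : ι → ℤ) (i : ι)
    (hm : (m i).toNat ≠ 0) :
    pointIdeal (P i) ∈ associatedPrimes (MvPolynomial (Fin (n + 1)) K)
      (MvPolynomial (Fin (n + 1)) K ⧸ fatPointIdeal P m) := by
  apply Module.associatedPrimes.minimalPrimes_annihilator_subset_associatedPrimes
  rw [Ideal.annihilator_quotient]
  have hle : fatPointIdeal P m ≤ pointIdeal (P i) :=
    (fatPointIdeal_le P m i).trans (Ideal.pow_le_self hm)
  refine ⟨⟨pointIdeal_isPrime (h0 i), hle⟩, fun q hq hqi => ?_⟩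
  have := hq.1
  exact (eq_pointIdeal_of_fatPointIdeal_le h0 hd m i hq.2 hqi).ge

theorem exists_eq_pointIdeal_of_mem_associatedPrimes (h0 : ∀ i, P i 0 ≠ 0)
    (hd : ∀ i j, i ≠ j → ¬ pointIdeal (P i) ≤ pointIdeal (P j)) (m : ι → ℤ)
    {q : Ideal (MvPolynomial (Fin (n + 1)) K)}
    (hq : q ∈ associatedPrimes (MvPolynomial (Fin (n + 1)) K)
      (MvPolynomial (Fin (n + 1)) K ⧸ fatPointIdeal P m)) : ∃ i, q = pointIdeal (P i) := by
  obtain ⟨hqp, x, hx⟩ := Submodule.isAssociatedPrime_iff.1 hq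
  obtain ⟨g, rfl⟩ := Ideal.Quotient.mk_surjective x
  have hmem : ∀ f, f ∈ q ↔ f * g ∈ fatPointIdeal P m := by
    intro f
    rw [hx, Submodule.mem_colon_singleton, ← Ideal.Quotient.eq_zero_iff_mem, map_mul,
      Submodule.mem_bot]
    rfl
  have hg : g ∉ fatPointIdeal P m := fun hg => hqp.ne_top <| (Ideal.eq_top_iff_one _).2 <|
    (hmem 1).2 (by simpa using hg)
  obtain ⟨i, hi⟩ : ∃ i, g ∉ pointIdeal (P i) ^ (m i).toNat := by
    by_contra! h
    exact hg (Ideal.mem_iInf.2 h)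
  -- Here `q` is the annihilator of the class of `g`, and `g` misses the `i`-th primary component,
  -- so `f g` in that component forces `f ∈ 𝔭ᵢ`.
  refine ⟨i, eq_pointIdeal_of_fatPointIdeal_le h0 hd m i
    (fun f hf => (hmem f).2 (Ideal.mul_mem_right _ _ hf)) fun f hf => ?_⟩
  by_contra hf'
  exact hi (mem_pointIdeal_pow_of_mul (h0 i) hf' (fatPointIdeal_le P m i ((hmem f).1 hf)))

theorem mem_symbolicPower_fatPointIdeal_iff (h0 : ∀ i, P i 0 ≠ 0)
    (hd : ∀ i j, i ≠ j → ¬ pointIdeal (P i) ≤ pointIdeal (P j)) (m : ι → ℤ) (M : ℕ)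
    (F : MvPolynomial (Fin (n + 1)) K) :
    F ∈ symbolicPower (fatPointIdeal P m) M ↔
      ∀ i, F ∈ pointIdeal (P i) ^ ((m i).toNat * M) := by
  simp only [symbolicPower, Ideal.mem_iInf, mem_map_localization_iff]
  constructor
  · intro h i
    by_cases hm : (m i).toNat = 0
    · simp [hm]
    obtain ⟨s, hs, hsF⟩ := h ⟨pointIdeal (P i), pointIdeal_isPrime (h0 i)⟩
      (pointIdeal_mem_associatedPrimes h0 hd m i hm)
    refine mem_pointIdeal_pow_of_mul (h0 i) hs ?_
    rw [pow_mul]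
    exact Ideal.pow_right_mono (fatPointIdeal_le P m i) M hsF
  · rintro h ⟨q, hqp⟩ hq
    obtain ⟨i, rfl⟩ := exists_eq_pointIdeal_of_mem_associatedPrimes h0 hd m hq
    obtain ⟨s, hs, hs'⟩ := exists_mem_forall_ne_pow_notMem h0 hd (fun j => (m j).toNat) i
    refine ⟨s ^ M, fun hsM => hs (hqp.mem_of_pow_mem _ hsM), ?_⟩
    -- Raised to the `M`-th power, this makes `s ^ M` the denominator that puts `F` in the localized
    -- `I ^ M`.
    have hle : Ideal.span {s} * pointIdeal (P i) ^ (m i).toNat ≤ fatPointIdeal P m := by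
      refine le_iInf fun j => ?_
      by_cases hj : j = i
      · subst hj
        exact Ideal.mul_le_right
      · exact Ideal.mul_le_left.trans ((Ideal.span_singleton_le_iff_mem _).2 (hs' j hj))
    refine Ideal.pow_right_mono hle M ?_
    rw [mul_pow, ← pow_mul]
    exact Ideal.mul_mem_mul (Ideal.pow_mem_pow (Ideal.mem_span_singleton_self s) M) (h i)

end SymbolicPower

/-! ### Polynomials with high multiplicity on a two-valued grid. -/

section Grid

variable {A : Type*} [CommRing A]

/-- Translation of the variables by the vector `v`. -/
def translate {σ : Type*} (v : σ → A) : MvPolynomial σ A →ₐ[A] MvPolynomial σ A :=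
  aeval fun j => X j + C (v j)

theorem translate_X {σ : Type*} (v : σ → A) (j : σ) : translate v (X j) = X j + C (v j) := by
  simp [translate]

theorem translate_X_sub_C {σ : Type*} (v : σ → A) (j : σ) (a : A) :
    translate v (X j - C a) = X j + C (v j - a) := by
  rw [map_sub, translate_X, MvPolynomial.algHom_C, MvPolynomial.algebraMap_eq, C_sub, add_sub_assoc]

theorem map_translate {B σ : Type*} [CommRing B] (φ : A →+* B) (v : σ → A)
    (F : MvPolynomial σ A) :
    MvPolynomial.map φ (translate v F) = translate (φ ∘ v) (MvPolynomial.map φ F) := by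
  induction F using MvPolynomial.induction_on with
  | C r => simp [translate, MvPolynomial.algebraMap_eq]
  | add f g hf hg => simp [hf, hg]
  | mul_X f i hf => simp [hf, translate_X]

theorem map_mem_pow_idealOfVars {B σ : Type*} [CommRing B] (φ : A →+* B) {m : ℕ}
    {F : MvPolynomial σ A} (hF : F ∈ idealOfVars σ A ^ m) :
    MvPolynomial.map φ F ∈ idealOfVars σ B ^ m := by
  rw [mem_pow_idealOfVars_iff'] at *
  intro x hx
  rw [coeff_map, hF x hx, map_zero]

/-- Restriction to the hyperplane `x₀ = c`. -/
def restrictHyperplane {n : ℕ} (c : A) :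
    MvPolynomial (Fin (n + 1)) A →ₐ[A] MvPolynomial (Fin n) A :=
  aeval (Fin.cases (C c) X)

theorem restrictHyperplane_X_zero {n : ℕ} (c : A) :
    restrictHyperplane (n := n) c (X 0) = C c := by
  simp [restrictHyperplane]

theorem restrictHyperplane_X_succ {n : ℕ} (c : A) (j : Fin n) :
    restrictHyperplane c (X j.succ) = X j := by
  simp [restrictHyperplane]

theorem X_sub_C_dvd_of_restrictHyperplane_eq_zero {n : ℕ} {c : A}
    {F : MvPolynomial (Fin (n + 1)) A} (h : restrictHyperplane c F = 0) : X 0 - C c ∣ F := by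
  have key : (Ideal.Quotient.mkₐ A (Ideal.span {X 0 - C c})).comp
      ((rename Fin.succ).comp (restrictHyperplane (n := n) c)) =
      Ideal.Quotient.mkₐ A (Ideal.span {X 0 - C c}) := by
    refine MvPolynomial.algHom_ext fun i => ?_
    refine Fin.cases ?_ (fun j => ?_) i
    · simp only [AlgHom.comp_apply, restrictHyperplane_X_zero, rename_C,
        Ideal.Quotient.mkₐ_eq_mk]
      refine (Ideal.Quotient.eq.2 ?_).symm
      exact Ideal.mem_span_singleton_self _
    · simp [restrictHyperplane_X_succ]
  have := DFunLike.congr_fun key F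
  simp only [AlgHom.comp_apply, h, map_zero, Ideal.Quotient.mkₐ_eq_mk] at this
  exact Ideal.mem_span_singleton.1 (Ideal.Quotient.eq_zero_iff_mem.1 this.symm)

theorem restrictHyperplane_translate {n : ℕ} (c : A) (v : Fin n → A)
    (F : MvPolynomial (Fin (n + 1)) A) :
    restrictHyperplane 0 (translate (Fin.cons c v) F) = translate v (restrictHyperplane c F) := by
  have : (restrictHyperplane 0).comp (translate (Fin.cons c v)) =
      (translate v).comp (restrictHyperplane c) := by
    refine MvPolynomial.algHom_ext fun i => ?_
    refine Fin.cases ?_ (fun j => ?_) i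
    · simp [restrictHyperplane_X_zero, translate_X, MvPolynomial.algHom_C, MvPolynomial.algebraMap_eq]
    · simp [restrictHyperplane_X_succ, translate_X, MvPolynomial.algHom_C, MvPolynomial.algebraMap_eq]
  exact DFunLike.congr_fun this F

theorem restrictHyperplane_mem_pow {n m : ℕ} {F : MvPolynomial (Fin (n + 1)) A}
    (hF : F ∈ idealOfVars (Fin (n + 1)) A ^ m) :
    restrictHyperplane 0 F ∈ idealOfVars (Fin n) A ^ m := by
  have hle : idealOfVars (Fin (n + 1)) A ≤
      (idealOfVars (Fin n) A).comap (restrictHyperplane (A := A) 0) := by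
    refine Ideal.span_le.2 ?_
    rintro _ ⟨i, rfl⟩
    refine Fin.cases ?_ (fun j => ?_) i
    · simp [restrictHyperplane_X_zero]
    · rw [SetLike.mem_coe, Ideal.mem_comap, restrictHyperplane_X_succ]
      exact Ideal.subset_span ⟨j, rfl⟩
  exact Ideal.le_comap_pow _ m (Ideal.pow_right_mono hle m hF)

theorem totalDegree_restrictHyperplane_le [Nontrivial A] {n : ℕ} (c : A) (F : MvPolynomial (Fin (n + 1)) A) :
    (restrictHyperplane c F).totalDegree ≤ F.totalDegree := by
  rw [restrictHyperplane, aeval_def, eval₂_eq']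
  refine totalDegree_finsetSum_le fun d hd => ?_
  refine (totalDegree_mul _ _).trans ?_
  rw [MvPolynomial.algebraMap_eq, totalDegree_C, zero_add]
  refine (totalDegree_finsetProd _ _).trans ((Finset.sum_le_sum fun i _ => ?_).trans
    ((Finsupp.sum_fintype d (fun _ e => e) fun _ => rfl).symm.le.trans (le_totalDegree hd)))
  refine (totalDegree_pow _ _).trans ?_
  refine mul_le_of_le_one_right (Nat.zero_le _) ?_
  refine Fin.cases ?_ (fun j => ?_) i
  · simp
  · simp

/-- Double induction on dimension and multiplicity. If `H` is nonzero on `x₀ = 0` or on `x₀ = c`,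
its restriction there has the same multiplicities on a smaller grid. Otherwise `x₀ (x₀ - c)` divides
`H`, and removing it costs degree two and one unit of multiplicity at each vertex. -/
theorem two_mul_le_totalDegree [IsDomain A] {c : A} (hc : c ≠ 0) {n : ℕ} (m : ℕ)
    {H : MvPolynomial (Fin n) A} (hH : H ≠ 0)
    (hv : ∀ v : Fin n → A, (∀ j, v j = 0 ∨ v j = c) →
      translate v H ∈ idealOfVars (Fin n) A ^ m) : 2 * m ≤ H.totalDegree := by
  induction n generalizing m with
  | zero =>
    have h := (mem_pow_idealOfVars_iff' _ _).1 (hv 0 fun j => j.elim0) 0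
    obtain ⟨r, rfl⟩ := C_surjective (R := A) (Fin 0) H
    have : r ≠ 0 := by rintro rfl; simp at hH
    by_contra hm
    have hm : 0 < m := by omega
    exact this (by simpa [translate, MvPolynomial.algebraMap_eq] using h (by simpa using hm))
  | succ n ih =>
    induction m generalizing H with
    | zero => simp
    | succ m ihm =>
      have restr : ∀ a, (a = 0 ∨ a = c) → restrictHyperplane a H ≠ 0 →
          2 * (m + 1) ≤ H.totalDegree := by
        intro a ha h0
        refine (ih (m + 1) h0 fun v hv' => ?_).trans (totalDegree_restrictHyperplane_le a H)
        rw [← restrictHyperplane_translate]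
        refine restrictHyperplane_mem_pow (hv _ fun j => ?_)
        refine Fin.cases ?_ (fun j => ?_) j
        · simpa using ha
        · simpa using hv' j
      by_cases h0 : restrictHyperplane 0 H = 0
      swap
      · exact restr 0 (.inl rfl) h0
      by_cases h1 : restrictHyperplane c H = 0
      swap
      · exact restr c (.inr rfl) h1
      obtain ⟨H₁, rfl⟩ := X_sub_C_dvd_of_restrictHyperplane_eq_zero h0
      rw [map_mul, map_sub, restrictHyperplane_X_zero, mul_eq_zero] at h1
      obtain ⟨H₂, rfl⟩ := X_sub_C_dvd_of_restrictHyperplane_eq_zero <| h1.resolve_left <| by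
        simpa [restrictHyperplane, MvPolynomial.algebraMap_eq] using hc
      have hdeg : ∀ a : A, (X 0 - C a : MvPolynomial (Fin (n + 1)) A).totalDegree = 1 := by
        intro a
        rw [sub_eq_add_neg, ← C_neg, totalDegree_add_eq_left_of_totalDegree_lt] <;> simp
      have hne : ∀ a : A, (X 0 - C a : MvPolynomial (Fin (n + 1)) A) ≠ 0 := by
        intro a ha
        simpa [ha] using hdeg a
      have hH₂ : H₂ ≠ 0 := by
        rintro rfl
        simp at hH
      rw [totalDegree_mul_of_isDomain (hne 0) (mul_ne_zero (hne c) hH₂),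
        totalDegree_mul_of_isDomain (hne c) hH₂, hdeg, hdeg]
      suffices 2 * m ≤ H₂.totalDegree by omega
      refine ihm hH₂ fun v hv' => ?_
      -- After translation to a vertex, one of the two linear factors becomes `x₀`, of order one,
      -- and the other has nonzero constant term, hence order zero.
      have hX : (X 0 : MvPolynomial (Fin (n + 1)) A) ∉ idealOfVars (Fin (n + 1)) A ^ (1 + 1) := by
        rw [X, monomial_mem_pow_idealOfVars_iff _ _ one_ne_zero]
        simp
      have hC : ∀ a : A, a ≠ 0 → (X 0 + C a : MvPolynomial (Fin (n + 1)) A) ∉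
          idealOfVars (Fin (n + 1)) A := fun a ha => by
        rw [mem_idealOfVars_iff]
        simpa using ha
      have h := hv v hv'
      rw [map_mul, map_mul, translate_X_sub_C, translate_X_sub_C, sub_zero] at h
      rcases hv' 0 with h0 | h0 <;> rw [h0] at h
      · rw [zero_sub, C_0, add_zero, mul_left_comm] at h
        have := mem_pow_idealOfVars_of_mul (hC (-c) (neg_ne_zero.2 hc)) h
        exact mem_pow_add_idealOfVars_of_mul hX (by rwa [add_comm 1])
      · rw [sub_self, C_0, add_zero] at h
        have := mem_pow_idealOfVars_of_mul (hC c hc) h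
        exact mem_pow_add_idealOfVars_of_mul hX (by rwa [add_comm 1])

end Grid

/-! ### The vertices of a shrinking cube collide. -/

section Collision

variable {A B σ : Type*} [CommRing A] [CommRing B]

/-- The scaling `y ↦ τ y` of the variables. -/
def scale (τ : B) : MvPolynomial σ B →ₐ[B] MvPolynomial σ B :=
  aeval fun j => C τ * X j

theorem coeff_scale (τ : B) (F : MvPolynomial σ B) (a : σ →₀ ℕ) :
    (scale τ F).coeff a = τ ^ a.degree * F.coeff a := by
  classical
  induction F using MvPolynomial.induction_on' with
  | monomial b r =>
    have : scale τ (monomial b r) = monomial b (τ ^ b.degree * r) := by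
      rw [scale, aeval_monomial, MvPolynomial.algebraMap_eq, monomial_eq, Finsupp.prod,
        Finsupp.prod]
      simp only [mul_pow, Finset.prod_mul_distrib, Finset.prod_pow_eq_pow_sum,
        Finsupp.degree_apply, C_mul, C_pow]
      ring
    rw [this, coeff_monomial, coeff_monomial]
    split_ifs with h
    · rw [h]
    · simp
  | add f g hf hg => rw [map_add, coeff_add, coeff_add, hf, hg, mul_add]

theorem translate_scale (τ : B) (v : σ → B) (F : MvPolynomial σ B) :
    translate v (scale τ F) = scale τ (translate (fun j => τ * v j) F) := by
  have : (translate v).comp (scale τ) = (scale τ).comp (translate fun j => τ * v j) := by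
    refine MvPolynomial.algHom_ext fun i => ?_
    simp [translate, scale, MvPolynomial.algebraMap_eq, mul_add]
  exact DFunLike.congr_fun this F

/-- Here `ρ` is reduction modulo `τ`. Suppose a term of exponent `a`, of degree below `2 m`,
survives reduction. Rescaling by `τ` and dividing by the exact power `τ ^ e` gives `H`, whose
reduction has degree at most `e ≤ a.degree < 2 m`, against the grid bound. -/
theorem map_mem_pow_two_mul_of_collision [IsDomain A] [IsDomain B] [IsNoetherianRing B]
    (ρ : B →+* A) {τ : B} (hτ : τ ≠ 0) (hρ : ∀ b, ρ b = 0 ↔ τ ∣ b) {c : B} (hc : ρ c ≠ 0)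
    {n m : ℕ} (G : MvPolynomial (Fin n) B)
    (hG : ∀ ε : Fin n → Bool, translate (fun j => if ε j then τ * c else 0) G ∈
      idealOfVars (Fin n) B ^ m) :
    MvPolynomial.map ρ G ∈ idealOfVars (Fin n) A ^ (2 * m) := by
  rw [mem_pow_idealOfVars_iff']
  intro a ha
  by_contra hGa
  rw [coeff_map, hρ] at hGa
  have hS : scale τ G ≠ 0 := by
    intro h0
    have := congrArg (coeff a) h0
    rw [coeff_scale, coeff_zero] at this
    rcases mul_eq_zero.1 this with h | h
    · exact pow_ne_zero _ hτ h
    · exact hGa (h ▸ dvd_zero τ)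
  have hunit : ¬ IsUnit (C τ : MvPolynomial (Fin n) B) := by
    rw [isUnit_iff_dvd_one, ← C_1, C_dvd_iff_dvd_coeff]
    intro h
    have h1 := (hρ _).2 (h 0)
    simp at h1
  obtain ⟨H, hH, hH'⟩ :=
    (FiniteMultiplicity.of_not_isUnit hunit hS).exists_eq_pow_mul_and_not_dvd
  set e := multiplicity (C τ) (scale τ G)
  have hcoeff : ∀ b, τ ^ e * H.coeff b = τ ^ b.degree * G.coeff b := by
    intro b
    rw [← coeff_scale, hH, ← C_pow, coeff_C_mul]
  have hH0 : MvPolynomial.map ρ H ≠ 0 := by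
    intro h
    refine hH' ((C_dvd_iff_dvd_coeff _ _).2 fun b => (hρ _).1 ?_)
    rw [← coeff_map, h, coeff_zero]
  -- In `τ ^ e * H_b = τ ^ |b| * G_b`, having `|b| > e` makes `H_b` divisible by `τ`; symmetrically
  -- `e > |a|` would make `G_a` divisible by `τ`.
  have hdeg : (MvPolynomial.map ρ H).totalDegree ≤ e := by
    refine Finset.sup_le fun b hb => ?_
    change b.degree ≤ e
    by_contra! hlt
    rw [mem_support_iff, coeff_map, Ne, hρ] at hb
    have := hcoeff b
    obtain ⟨r, hr⟩ := Nat.exists_eq_add_of_lt hlt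
    rw [hr, add_assoc, pow_add, mul_assoc] at this
    rw [mul_left_cancel₀ (pow_ne_zero _ hτ) this, pow_succ'] at hb
    exact hb ⟨_, by rw [mul_assoc]⟩
  have he : e ≤ a.degree := by
    by_contra! hlt
    have := hcoeff a
    obtain ⟨r, hr⟩ := Nat.exists_eq_add_of_lt hlt
    rw [hr, add_assoc, pow_add, mul_assoc] at this
    rw [← mul_left_cancel₀ (pow_ne_zero _ hτ) this, pow_succ'] at hGa
    exact hGa ⟨_, by rw [mul_assoc]⟩
  have := two_mul_le_totalDegree hc m hH0 fun v hv => ?_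
  · omega
  choose ε hε using fun j => show ∃ b : Bool, v j = if b then ρ c else 0 by
    rcases hv j with h | h
    · exact ⟨false, by simpa using h⟩
    · exact ⟨true, by simpa using h⟩
  have h1 : translate (fun j => if ε j then c else 0) H ∈ idealOfVars (Fin n) B ^ m := by
    have h2 := hG ε
    rw [mem_pow_idealOfVars_iff'] at h2 ⊢
    intro x hx
    have h3 : (translate (fun j => if ε j then c else 0) (scale τ G)).coeff x = 0 := by
      rw [translate_scale, coeff_scale]
      simp only [mul_ite, mul_zero, h2 x hx]
    rw [hH, map_mul, map_pow, MvPolynomial.algHom_C, MvPolynomial.algebraMap_eq, ← C_pow,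
      coeff_C_mul] at h3
    exact (mul_eq_zero.1 h3).resolve_left (pow_ne_zero _ hτ)
  have h4 := map_mem_pow_idealOfVars ρ h1
  rw [map_translate] at h4
  convert h4 using 3
  ext j
  rw [hε j]
  by_cases h : ε j <;> simp [h]

end Collision

/-! ### Solvability of linear systems under specialization. -/

section Specialization

open Matrix in
-- Rank cannot grow under specialization. If the specialized rows spanned, some maximal minor would
-- be nonzero after `φ`, yet that minor is zero in `R`, since it vanishes under the injective `j`.
-- So a nonzero functional kills the rows, and clearing its denominators gives `w`. Infinitely many
-- rows are allowed.
theorem exists_mulVec_eq_zero_of_specialization {R S K : Type*} [CommRing R] [CommRing S]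
    [IsDomain S] [Field K] {ρ κ : Type*} [Fintype κ] (φ : R →+* S) (j : R →+* K)
    (hj : Function.Injective j) (A : Matrix ρ κ R)
    (h : ∃ v : κ → K, v ≠ 0 ∧ A.map j *ᵥ v = 0) :
    ∃ w : κ → S, w ≠ 0 ∧ A.map φ *ᵥ w = 0 := by
  classical
  let L := FractionRing S
  let f : R →+* L := (algebraMap S L).comp φ
  by_cases htop : Submodule.span L (Set.range (A.map f)) = ⊤
  · exfalso
    obtain ⟨κ', a, -, hspan, hli⟩ := exists_linearIndependent' L (A.map f)
    rw [htop] at hspan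
    let b := Module.Basis.mk hli hspan.ge
    let e := b.indexEquiv (Pi.basisFun L κ)
    have hdet : ((A.map f).submatrix (a ∘ e.symm) id).det ≠ 0 := by
      rw [← isUnit_iff_ne_zero, ← Matrix.isUnit_iff_isUnit_det,
        ← Matrix.linearIndependent_rows_iff_isUnit]
      exact hli.comp _ e.symm.injective
    obtain ⟨v, hv, hAv⟩ := h
    have h0 : ((A.map j).submatrix (a ∘ e.symm) id).det = 0 := by
      rw [← Matrix.exists_mulVec_eq_zero_iff]
      refine ⟨v, hv, funext fun i => ?_⟩
      exact congrFun hAv (a (e.symm i))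
    have h1 : (A.submatrix (a ∘ e.symm) id).det = 0 := by
      apply hj
      rw [map_zero, RingHom.map_det]
      exact h0
    apply hdet
    have := congrArg f h1
    rw [map_zero, RingHom.map_det] at this
    exact this
  · obtain ⟨g, hg, hle⟩ := Submodule.exists_le_ker_of_lt_top _ (lt_top_iff_ne_top.2 htop)
    obtain ⟨d, hd⟩ := IsLocalization.exist_integer_multiples (nonZeroDivisors S) Finset.univ
      fun i => g (Pi.single i 1)
    choose w hw using fun i => hd i (Finset.mem_univ i)
    have hd0 : algebraMap S L d ≠ 0 := IsFractionRing.to_map_ne_zero_of_mem_nonZeroDivisors d.2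
    have hg' : ∀ x : κ → L, g x = ∑ i, x i * g (Pi.single i 1) := by
      intro x
      conv_lhs => rw [← (Pi.basisFun L κ).sum_repr x]
      simp
    refine ⟨w, ?_, ?_⟩
    · rintro rfl
      apply hg
      ext i
      have := hw i
      simp only [Pi.zero_apply, map_zero, Algebra.smul_def] at this
      simpa using (mul_eq_zero.1 this.symm).resolve_left hd0
    · funext r
      apply IsFractionRing.injective S L
      have h1 : g (A.map f r) = 0 := hle (Submodule.subset_span ⟨r, rfl⟩)
      rw [hg'] at h1
      simp only [Matrix.mulVec, dotProduct, map_sum, map_mul, hw, Pi.zero_apply, map_zero,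
        Algebra.smul_def]
      calc _ = algebraMap S L d * ∑ i, A.map f r i * g (Pi.single i 1) := by
            rw [Finset.mul_sum]
            refine Finset.sum_congr rfl fun i _ => ?_
            simp only [Matrix.map_apply, f, RingHom.comp_apply]
            ring
        _ = 0 := by rw [h1, mul_zero]

/-- The matrix of the conditions `localExpansion (P i) F ∈ idealOfVars ^ m i` on the coefficients
of a polynomial `F` with exponents in `s`. -/
def expansionMatrix {R ι : Type*} [CommRing R] {n : ℕ} (P : ι → Fin (n + 1) → R) (m : ι → ℕ)
    (s : Finset (Fin (n + 1) →₀ ℕ)) : Matrix {r : ι × (Fin n →₀ ℕ) × ℕ // r.2.1.degree < m r.1}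
      s R :=
  fun r c => ((localExpansion (P r.1.1) (monomial c.1 1)).coeff r.1.2.1).coeff r.1.2.2

open Matrix in
theorem expansionMatrix_map_mulVec {R T ι : Type*} [CommRing R] [CommRing T] (ψ : R →+* T) {n : ℕ}
    (P : ι → Fin (n + 1) → R) (m : ι → ℕ)
    (s : Finset (Fin (n + 1) →₀ ℕ)) (w : s → T)
    (r : {r : ι × (Fin n →₀ ℕ) × ℕ // r.2.1.degree < m r.1}) :
    ((expansionMatrix P m s).map ψ *ᵥ w) r = ((localExpansion (ψ ∘ P r.1.1)
      (∑ c, monomial c.1 (w c))).coeff r.1.2.1).coeff r.1.2.2 := by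
  simp only [map_sum, coeff_sum, Polynomial.finsetSum_coeff, Matrix.mulVec, dotProduct]
  refine Finset.sum_congr rfl fun c _ => ?_
  have : monomial c.1 (w c) = C (w c) * MvPolynomial.map ψ (monomial c.1 1) := by
    simp [C_mul_monomial]
  rw [this, map_mul, localExpansion_C, coeff_C_mul, Polynomial.coeff_C_mul,
    ← map_localExpansion, coeff_map, mul_comm]
  simp [expansionMatrix]

theorem expansionMatrix_map_mulVec_eq_zero_iff {R T ι : Type*} [CommRing R] [CommRing T]
    (ψ : R →+* T) {n : ℕ} (P : ι → Fin (n + 1) → R) (m : ι → ℕ)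
    (s : Finset (Fin (n + 1) →₀ ℕ)) (w : s → T) :
    ((expansionMatrix P m s).map ψ).mulVec w = 0 ↔ ∀ i, localExpansion (ψ ∘ P i)
      (∑ c, monomial c.1 (w c)) ∈ idealOfVars (Fin n) (Polynomial T) ^ m i := by
  simp only [mem_pow_idealOfVars_iff', Polynomial.ext_iff, _root_.funext_iff,
    expansionMatrix_map_mulVec]
  exact ⟨fun h i x hx b => h ⟨(i, x, b), hx⟩, fun h r => h _ _ r.2 _⟩

theorem exists_finset_mem_iff_degree_eq (n d : ℕ) :
    ∃ s : Finset (Fin n →₀ ℕ), ∀ c, c ∈ s ↔ c.degree = d :=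
  ⟨Finset.univ.finsuppAntidiag d, fun c => by
    simp [Finset.mem_finsuppAntidiag, Finsupp.degree_eq_sum]⟩

theorem sum_monomial_coeff {R σ : Type*} [CommRing R] {s : Finset (σ →₀ ℕ)}
    {F : MvPolynomial σ R} (hF : F.support ⊆ s) :
    ∑ c : s, monomial c.1 (F.coeff c.1) = F := by
  rw [Finset.sum_coe_sort _ fun c => monomial c (F.coeff c)]
  conv_rhs => rw [F.as_sum]
  refine (Finset.sum_subset hF fun c _ hc => ?_).symm
  rw [notMem_support_iff.1 hc, monomial_zero]

theorem coeff_sum_monomial {R : Type*} [CommRing R] {σ : Type*} (s : Finset (σ →₀ ℕ))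
    (w : s → R) (c : s) : (∑ c : s, monomial c.1 (w c)).coeff c.1 = w c := by
  classical
  simp [coeff_sum, coeff_monomial]

theorem exists_isHomogeneous_of_specialization {R S K : Type*} [CommRing R] [CommRing S]
    [IsDomain S] [Field K] (φ : R →+* S) (j : R →+* K) (hj : Function.Injective j)
    {ι : Type*} {n : ℕ} (P : ι → Fin (n + 1) → R) (m : ι → ℕ) (d : ℕ)
    (h : ∃ F : MvPolynomial (Fin (n + 1)) K, F ≠ 0 ∧ F.IsHomogeneous d ∧
      ∀ i, localExpansion (j ∘ P i) F ∈ idealOfVars (Fin n) (Polynomial K) ^ m i) :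
    ∃ F : MvPolynomial (Fin (n + 1)) S, F ≠ 0 ∧ F.IsHomogeneous d ∧
      ∀ i, localExpansion (φ ∘ P i) F ∈ idealOfVars (Fin n) (Polynomial S) ^ m i := by
  obtain ⟨F, hF0, hFd, hF⟩ := h
  obtain ⟨s, hs⟩ := exists_finset_mem_iff_degree_eq (n + 1) d
  have hFs : F.support ⊆ s := fun c hc => by
    rw [hs, Finsupp.degree_eq_weight_one]
    exact hFd (mem_support_iff.1 hc)
  have hker : ∃ v : s → K, v ≠ 0 ∧ ((expansionMatrix P m s).map j).mulVec v = 0 := by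
    refine ⟨fun c => F.coeff c.1, fun h0 => hF0 ?_, ?_⟩
    · rw [← sum_monomial_coeff hFs]
      exact Finset.sum_eq_zero fun c _ => by
        rw [show F.coeff c.1 = 0 from congrFun h0 c, monomial_zero]
    · rw [expansionMatrix_map_mulVec_eq_zero_iff]
      intro i
      rw [sum_monomial_coeff hFs]
      exact hF i
  obtain ⟨w, hw, hAw⟩ := exists_mulVec_eq_zero_of_specialization φ j hj _ hker
  have h0 : ∑ c, monomial c.1 (w c) ≠ 0 := fun h0 => hw <| funext fun c => by
    have hc := coeff_sum_monomial s w c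
    rw [h0, coeff_zero] at hc
    exact hc.symm
  have hd : (∑ c, monomial c.1 (w c)).IsHomogeneous d :=
    IsHomogeneous.sum Finset.univ _ d fun c _ => isHomogeneous_monomial _ ((hs c.1).1 c.2)
  have hm := (expansionMatrix_map_mulVec_eq_zero_iff φ P m s w).1 hAw
  exact ⟨_, h0, hd, hm⟩

end Specialization

/-! ### The limit of a family of forms. -/

section Degeneration

/-- Since `x₀ ↦ L P₀` contains no `y`, moving the point with its zeroth coordinate fixed amounts to
shifting `y` by `L v`. -/
theorem translate_localExpansion {R : Type*} [CommRing R] {n : ℕ} (P v : Fin (n + 1) → R)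
    (hv : v 0 = 0) (F : MvPolynomial (Fin (n + 1)) R) :
    translate (fun j => Polynomial.X * Polynomial.C (v j.succ)) (localExpansion P F) =
      localExpansion (P + v) F := by
  induction F using MvPolynomial.induction_on with
  | C r => simp [translate, MvPolynomial.algebraMap_eq]
  | add f g hf hg => simp only [map_add, hf, hg]
  | mul_X f i hf =>
    rw [map_mul, map_mul, map_mul, hf, localExpansion_X, localExpansion_X]
    congr 1
    refine Fin.cases ?_ (fun j => ?_) i
    · simp [translate, MvPolynomial.algebraMap_eq, hv]
    · simp only [map_add, translate_X, MvPolynomial.algHom_C, MvPolynomial.algebraMap_eq,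
        Fin.cases_succ, Pi.add_apply, mul_add]
      ring

theorem mem_pow_idealOfVars_of_C_mul {σ A : Type*} [CommRing A] [IsDomain A] {a : A} (ha : a ≠ 0)
    {m : ℕ} {F : MvPolynomial σ A} (h : C a * F ∈ idealOfVars σ A ^ m) :
    F ∈ idealOfVars σ A ^ m := by
  rw [mem_pow_idealOfVars_iff'] at *
  intro x hx
  have := h x hx
  rw [coeff_C_mul] at this
  exact (mul_eq_zero.1 this).resolve_left ha

variable {K : Type*} [Field K] {n : ℕ}

theorem eval_zero_eq_zero_iff_C_X_dvd {σ : Type*} (F : MvPolynomial σ (Polynomial K)) :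
    MvPolynomial.map (Polynomial.evalRingHom 0) F = 0 ↔ C Polynomial.X ∣ F := by
  simp [C_dvd_iff_dvd_coeff, Polynomial.X_dvd_iff, MvPolynomial.ext_iff, coeff_map,
    Polynomial.coeff_zero_eq_eval_zero]

theorem mapRingHom_eval_zero_eq_zero_iff (b : Polynomial (Polynomial K)) :
    Polynomial.mapRingHom (Polynomial.evalRingHom 0) b = 0 ↔
      Polynomial.C Polynomial.X ∣ b := by
  simp [Polynomial.C_dvd_iff_dvd_coeff, Polynomial.X_dvd_iff, Polynomial.ext_iff,
    Polynomial.coeff_zero_eq_eval_zero]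

/-- If a family of forms over `K[t]` vanishes to order `m` at the vertices `Q + t v` of a cube
shrinking to `Q`, then its limit vanishes to order `2 m` at `Q`. -/
theorem exists_isHomogeneous_limit {β γ : Type*} (Q : β → Fin (n + 1) → K)
    (Q' : γ → Fin (n + 1) → K) (m : ℕ) (m' : γ → ℕ) (d : ℕ)
    {F : MvPolynomial (Fin (n + 1)) (Polynomial K)} (hF0 : F ≠ 0) (hFd : F.IsHomogeneous d)
    (hF : ∀ i (ε : Fin n → Bool), localExpansion (Polynomial.C ∘ Q i +
      Fin.cons 0 fun j => if ε j then Polynomial.X else 0) F ∈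
        idealOfVars (Fin n) (Polynomial (Polynomial K)) ^ m)
    (hF' : ∀ i, localExpansion (Polynomial.C ∘ Q' i) F ∈
      idealOfVars (Fin n) (Polynomial (Polynomial K)) ^ m' i) :
    ∃ F₀ : MvPolynomial (Fin (n + 1)) K, F₀ ≠ 0 ∧ F₀.IsHomogeneous d ∧
      (∀ i, localExpansion (Q i) F₀ ∈ idealOfVars (Fin n) (Polynomial K) ^ (2 * m)) ∧
      ∀ i, localExpansion (Q' i) F₀ ∈ idealOfVars (Fin n) (Polynomial K) ^ m' i := by
  have hunit : ¬ IsUnit (C Polynomial.X : MvPolynomial (Fin (n + 1)) (Polynomial K)) := by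
    rw [isUnit_iff_dvd_one, ← eval_zero_eq_zero_iff_C_X_dvd]
    simp
  obtain ⟨G, hG, hG'⟩ :=
    (FiniteMultiplicity.of_not_isUnit hunit hF0).exists_eq_pow_mul_and_not_dvd
  set e := multiplicity (C Polynomial.X) F
  rw [← C_pow] at hG
  have hX : (Polynomial.X : Polynomial K) ^ e ≠ 0 := pow_ne_zero _ Polynomial.X_ne_zero
  have hcancel : ∀ (P : Fin (n + 1) → Polynomial K) (l : ℕ), localExpansion P F ∈
      idealOfVars (Fin n) (Polynomial (Polynomial K)) ^ l → localExpansion P G ∈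
      idealOfVars (Fin n) (Polynomial (Polynomial K)) ^ l := by
    intro P l h
    rw [hG, map_mul, localExpansion_C] at h
    exact mem_pow_idealOfVars_of_C_mul (Polynomial.C_ne_zero.2 hX) h
  have hGd : G.IsHomogeneous d := by
    intro c hc
    apply hFd
    rw [hG, coeff_C_mul]
    exact mul_ne_zero hX hc
  have hQ : ∀ P : Fin (n + 1) → K, Polynomial.evalRingHom 0 ∘ Polynomial.C ∘ P = P := by
    intro P
    ext
    simp
  refine ⟨MvPolynomial.map (Polynomial.evalRingHom 0) G, ?_, hGd.map _, fun i => ?_,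
    fun i => ?_⟩
  · rwa [Ne, eval_zero_eq_zero_iff_C_X_dvd]
  · rw [← hQ (Q i), ← map_localExpansion]
    -- The vertex `Q + t ε` is the shift of `y` by `L t ε`, so `τ` is the parameter `t` and `c` is
    -- the line coordinate `L`, which survives at `t = 0`.
    refine map_mem_pow_two_mul_of_collision (τ := Polynomial.C Polynomial.X) (c := Polynomial.X) _
      (Polynomial.C_ne_zero.2 Polynomial.X_ne_zero) mapRingHom_eval_zero_eq_zero_iff
      (by simp) _ fun ε => ?_
    have := hcancel _ _ (hF i ε)
    rw [← translate_localExpansion _ _ (by simp)] at this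
    convert this using 3
    ext1 j
    by_cases h : ε j <;> simp [h, Polynomial.X_mul_C]
  · rw [← hQ (Q' i), ← map_localExpansion]
    exact map_mem_pow_idealOfVars _ (hcancel _ _ (hF' i))

end Degeneration

/-! ### Generic points and the comparison of initial degrees. -/

section Generic

variable (k : Type*) [Field k] (N : ℕ) {ι : Type*}

theorem genericPointCoords_ne_zero (i : ι) (j : Fin (N + 1)) :
    genericPointCoords k N i j ≠ 0 := by
  rw [genericPointCoords, Ne, IsFractionRing.to_map_eq_zero_iff]
  exact X_ne_zero _

theorem not_pointIdeal_genericPointCoords_le (hN : 1 ≤ N) {i j : ι} (hij : i ≠ j) :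
    ¬ pointIdeal (genericPointCoords k N i) ≤ pointIdeal (genericPointCoords k N j) := by
  classical
  have h01 : (Fin.last N) ≠ 0 := Fin.ne_of_gt (Nat.lt_of_succ_le hN)
  refine not_pointIdeal_le (i := 0) (j := Fin.last N) fun h => ?_
  simp only [genericPointCoords, ← map_mul] at h
  -- At this substitution one of the two products of coordinates becomes `1` and the other `0`.
  have := congrArg (eval fun x => if x = (i, 0) ∨ x = (j, Fin.last N) then (1 : k) else 0)
    (IsFractionRing.injective _ (GenericField k N ι) h)
  simp [hij, h01, hij.symm, h01.symm] at this

instance [Infinite k] : Infinite (GenericField k N ι) :=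
  Infinite.of_injective _ ((IsFractionRing.injective (MvPolynomial (ι × Fin (N + 1)) k)
    (GenericField k N ι)).comp (MvPolynomial.C_injective _ _))

theorem mem_symbolicPower_genericFatPointIdeal_iff [Infinite k] [Finite ι] (hN : 1 ≤ N)
    (m : ι → ℤ) (M : ℕ) (F : MvPolynomial (Fin (N + 1)) (GenericField k N ι)) :
    F ∈ symbolicPower (genericFatPointIdeal k N m) M ↔
      ∀ i, localExpansion (genericPointCoords k N i) F ∈
        idealOfVars (Fin N) (Polynomial (GenericField k N ι)) ^ ((m i).toNat * M) := by
  rw [genericFatPointIdeal, mem_symbolicPower_fatPointIdeal_iff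
    (fun i => genericPointCoords_ne_zero k N i 0)
    (fun i j => not_pointIdeal_genericPointCoords_le k N hN)]
  simp only [mem_pointIdeal_pow_iff (genericPointCoords_ne_zero k N _ 0)]

/-- Sending the generic points indexed by `β × {0, 1} ^ N` to the vertices of cubes of size `t`
around generic points indexed by `β`. -/
def cubeSpecialization {ι β γ : Type*} (e : ι → β × (Fin N → Bool)) :
    MvPolynomial ((ι ⊕ γ) × Fin (N + 1)) k →+* Polynomial (GenericField k N (β ⊕ γ)) :=
  eval₂Hom (Polynomial.C.comp (algebraMap k (GenericField k N (β ⊕ γ)))) fun x =>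
    Sum.elim
      (fun i => Polynomial.C ∘ genericPointCoords k N (Sum.inl (e i).1) +
        Fin.cons 0 fun j => if (e i).2 j then Polynomial.X else 0)
      (fun i => Polynomial.C ∘ genericPointCoords k N (Sum.inr i)) x.1 x.2

theorem cubeSpecialization_inl {ι β γ : Type*} (e : ι → β × (Fin N → Bool)) (i : ι) :
    (cubeSpecialization k N (γ := γ) e ∘ fun j => X (Sum.inl i, j)) =
      Polynomial.C ∘ genericPointCoords k N (Sum.inl (e i).1) +
        Fin.cons 0 fun j => if (e i).2 j then Polynomial.X else 0 := by
  funext j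
  simp [cubeSpecialization]

theorem cubeSpecialization_inr {ι β γ : Type*} (e : ι → β × (Fin N → Bool)) (i : γ) :
    (cubeSpecialization k N e ∘ fun j => X (Sum.inr i, j)) =
      Polynomial.C ∘ genericPointCoords k N (Sum.inr i) := by
  funext j
  simp [cubeSpecialization]

theorem initialDegree_symbolicPower_double_le [Infinite k] (hN : 1 ≤ N) {ι β γ : Type*}
    [Finite ι] [Finite β] [Finite γ] (e : ι ≃ β × (Fin N → Bool)) (m : γ → ℤ) (M : ℕ) :
    initialDegree (symbolicPower
        (genericFatPointIdeal k N (Sum.elim (fun _ : β => (2 : ℤ)) m)) M) ≤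
      initialDegree (symbolicPower
        (genericFatPointIdeal k N (Sum.elim (fun _ : ι => (1 : ℤ)) m)) M) := by
  obtain ⟨G, hG, hG0, d, hGd⟩ := exists_isHomogeneous_mem_symbolicPower
    (P := genericPointCoords k N) (fun i => ⟨0, Fin.last N,
      Fin.ne_of_lt (Nat.lt_of_succ_le hN), genericPointCoords_ne_zero k N i 0⟩)
    (Sum.elim (fun _ : ι => (1 : ℤ)) m) M
  obtain ⟨F, hF, hF0, hFd⟩ := Nat.sInf_mem (s := {d : ℕ | ∃ f ∈ symbolicPower
    (genericFatPointIdeal k N (Sum.elim (fun _ : ι => (1 : ℤ)) m)) M,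
      f ≠ 0 ∧ f.IsHomogeneous d}) ⟨d, G, hG, hG0, hGd⟩
  rw [mem_symbolicPower_genericFatPointIdeal_iff k N hN] at hF
  -- The indeterminates are specialized to cube vertices; `F'` solves the specialized system but
  -- need not be a specialization of `F`.
  obtain ⟨F', hF'0, hF'd, hF'⟩ := exists_isHomogeneous_of_specialization
    (cubeSpecialization k N (γ := γ) e) (algebraMap _ (GenericField k N (ι ⊕ γ)))
    (IsFractionRing.injective _ _) (fun i j => X (i, j)) _ _ ⟨F, hF0, hFd, hF⟩
  obtain ⟨F₀, h0, hd, h2, hm⟩ := exists_isHomogeneous_limit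
    (fun i : β => genericPointCoords k N (Sum.inl i : β ⊕ γ))
    (fun i : γ => genericPointCoords k N (Sum.inr i)) M (fun i => (m i).toNat * M) _ hF'0 hF'd
    (fun i ε => by
      have := hF' (Sum.inl (e.symm (i, ε)))
      rwa [cubeSpecialization_inl, e.apply_symm_apply, Sum.elim_inl, Int.toNat_one,
        one_mul] at this)
    (fun i => by
      have := hF' (Sum.inr i)
      rwa [cubeSpecialization_inr, Sum.elim_inr] at this)
  refine Nat.sInf_le ⟨F₀, (mem_symbolicPower_genericFatPointIdeal_iff k N hN _ M F₀).2 ?_, h0, hd⟩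
  rintro (i | i)
  · exact h2 i
  · exact hm i

theorem waldschmidtConstant_double_le [Infinite k] (hN : 1 ≤ N) {ι β γ : Type*}
    [Finite ι] [Finite β] [Finite γ] (e : ι ≃ β × (Fin N → Bool)) (m : γ → ℤ) :
    waldschmidtConstant (genericFatPointIdeal k N (Sum.elim (fun _ : β => (2 : ℤ)) m)) ≤
      waldschmidtConstant (genericFatPointIdeal k N (Sum.elim (fun _ : ι => (1 : ℤ)) m)) := by
  refine ciInf_mono ⟨0, ?_⟩ fun M => ?_
  · rintro _ ⟨M, rfl⟩
    positivity
  · gcongr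
    exact initialDegree_symbolicPower_double_le k N hN e m M

end Generic

end FatPoints

end

theorem mainTheorem5 (k : Type*) [Field k] [IsAlgClosed k] (N : ℕ) (hN : 1 ≤ N)
    (s : ℕ) (m : Fin s → ℤ) :
    FatPoints.waldschmidtConstant
        (FatPoints.genericFatPointIdeal k N
          (Sum.elim (fun _ : Fin (2 ^ N) => (1 : ℤ)) m)) ≥
      FatPoints.waldschmidtConstant
        (FatPoints.genericFatPointIdeal k N
          (Sum.elim (fun _ : Fin 1 => (2 : ℤ)) m)) ∧
    ∀ b : ℕ,
      FatPoints.waldschmidtConstant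
          (FatPoints.genericFatPointIdeal k N
            (Sum.elim (fun _ : Fin (b * 2 ^ N) => (1 : ℤ)) m)) ≥
        FatPoints.waldschmidtConstant
          (FatPoints.genericFatPointIdeal k N
            (Sum.elim (fun _ : Fin b => (2 : ℤ)) m)) := by
  have : Infinite k := inferInstance
  exact ⟨FatPoints.waldschmidtConstant_double_le k N hN
      (Fintype.equivOfCardEq (by simp)) m,
    fun b => FatPoints.waldschmidtConstant_double_le k N hN
      (Fintype.equivOfCardEq (by simp)) m⟩
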